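/- Let $G$ be a finite non-abelian group with center $Z(G)$. For $g\in G$ write $g^G$ for its conjugacy class. The CCC-graph (commuting conjugacy class graph) $\Gamma_G$ is the simple graph whose vertices are the conjugacy classes $g^G$ with $g\in G\setminus Z(G)$, two distinct classes being adjacent if some element of the first commutes with some element of the second. For a finite simple graph $\mathcal G$ with vertices $v_1,\dots,v_N$, let $\mathrm{CN}(\mathcal G)$ be the $N\times N$ matrix whose $(i,j)$ entry is the number of common neighbors of $v_i$ and $v_j$ if $i\neq j$, and $0$ if $i=j$; let $\mathrm{CNRS}(\mathcal G)$ be the diagonal matrix of row sums of $\mathrm{CN}(\mathcal G)$. The graph $\mathcal G$ is called CNL-integral (respectively CNSL-integral) if all eigenvalues of $\mathrm{CNRS}(\mathcal G)-\mathrm{CN}(\mathcal G)$ (respectively of $\mathrm{CNRS}(\mathcal G)+\mathrm{CN}(\mathcal G)$) are integers. Then $\Gamma_G$ is both CNL-integral and CNSL-integral if at least one of the following holds: 1. $G/Z(G)\cong \mathbb Z_p\times\mathbb Z_p$ for some prime $p$; 2. $G/Z(G)\cong D_{2n}$, the dihedral group of order $2n$, for some $n\ge 3$; 3. $G$ is isomorphic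 to one of the following groups: - $D_{2n}=\langle x,y : x^n=y^2=1,\ yxy^{-1}=x^{-1}\rangle$ with $n\ge 3$; - $T_{4n}=\langle x,y : x^{2n}=1,\ x^n=y^2,\ y^{-1}xy=x^{-1}\rangle$ with $n\ge 2$; - $U_{6n}=\langle x,y : x^{2n}=y^3=1,\ x^{-1}yx=y^{-1}\rangle$ with $n\ge 2$; - $U_{(n,m)}=\langle x,y : x^{2n}=y^m=1,\ x^{-1}yx=y^{-1}\rangle$ with $n\ge 2$, $m\ge 2$; - $SD_{8n}=\langle x,y : x^{4n}=y^2=1,\ yxy=x^{2n-1}\rangle$ with $n\ge 2$; - $V_{8n}=\langle x,y : x^{2n}=y^4=1,\ yx=x^{-1}y^{-1},\ y^{-1}x=x^{-1}y\rangle$ with $n\ge 2$. -/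

import Mathlib

section CommonNeighborhood

variable {V : Type*} [Fintype V]

open Classical in
/-- The common neighborhood matrix of a finite simple graph: the `(i, j)` entry is the number of
vertices adjacent to both `i` and `j` when `i ≠ j`, and `0` when `i = j`. (A common neighbor of
`i` and `j` in a simple graph is automatically different from `i` and from `j`.) -/
noncomputable def CN (Γ : SimpleGraph V) : Matrix V V ℤ :=
  Matrix.of fun i j => if i ≠ j then ((Γ.commonNeighbors i j).ncard : ℤ) else 0

open Classical in
/-- The diagonal matrix of the row sums of the common neighborhood matrix. -/
noncomputable def CNRS (Γ : SimpleGraph V) : Matrix V V ℤ :=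
  Matrix.diagonal fun i => ∑ k, CN Γ i k

/-- The common neighborhood Laplacian matrix. -/
noncomputable def CNL (Γ : SimpleGraph V) : Matrix V V ℤ := CNRS Γ - CN Γ

/-- The common neighborhood signless Laplacian matrix. -/
noncomputable def CNSL (Γ : SimpleGraph V) : Matrix V V ℤ := CNRS Γ + CN Γ

open Classical in
/-- The spectrum, with multiplicities, of a square integer matrix: the multiset of its complex
eigenvalues. -/
noncomputable def specWithMult (A : Matrix V V ℤ) : Multiset ℂ :=
  (A.map (Int.cast : ℤ → ℂ)).charpoly.roots

/-- The CNL-spectrum of a graph. -/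
noncomputable def CNLSpec (Γ : SimpleGraph V) : Multiset ℂ := specWithMult (CNL Γ)

/-- The CNSL-spectrum of a graph. -/
noncomputable def CNSLSpec (Γ : SimpleGraph V) : Multiset ℂ := specWithMult (CNSL Γ)

/-- A graph is CNL-integral if its CNL-spectrum contains only integers. -/
def IsCNLIntegral (Γ : SimpleGraph V) : Prop := ∀ α ∈ CNLSpec Γ, ∃ k : ℤ, α = (k : ℂ)

/-- A graph is CNSL-integral if its CNSL-spectrum contains only integers. -/
def IsCNSLIntegral (Γ : SimpleGraph V) : Prop := ∀ β ∈ CNSLSpec Γ, ∃ k : ℤ, β = (k : ℂ)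

end CommonNeighborhood

section CCC

/-- The conjugacy classes of the non-central elements of a group. -/
def CCCVertex (G : Type*) [Group G] : Type _ :=
  {C : ConjClasses G // ∃ x : G, x ∉ Subgroup.center G ∧ ConjClasses.mk x = C}

instance CCCVertex.instFinite (G : Type*) [Group G] [Finite G] : Finite (CCCVertex G) :=
  haveI : Finite (ConjClasses G) := Quotient.finite _
  Subtype.finite

noncomputable instance CCCVertex.instFintype (G : Type*) [Group G] [Finite G] :
    Fintype (CCCVertex G) :=
  Fintype.ofFinite _

/-- The commuting conjugacy class graph of a group: two distinct classes of non-central elements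
are adjacent if some element of the first commutes with some element of the second. -/
def CCCGraph (G : Type*) [Group G] : SimpleGraph (CCCVertex G) where
  Adj C D := C ≠ D ∧ ∃ x ∈ C.1.carrier, ∃ y ∈ D.1.carrier, x * y = y * x
  symm := ⟨fun _ _ ⟨hne, x, hx, y, hy, h⟩ => ⟨hne.symm, y, hy, x, hx, h.symm⟩⟩
  loopless := ⟨fun _ h => h.1 rfl⟩

end CCC

section Families

/-- The first generator of the free group on two letters. -/
def genX : FreeGroup (Fin 2) := FreeGroup.of 0

/-- The second generator of the free group on two letters. -/
def genY : FreeGroup (Fin 2) := FreeGroup.of 1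

/-- `U_{6n} = ⟨x, y : x^{2n} = y^3 = 1, x⁻¹ y x = y⁻¹⟩`. -/
abbrev GroupUSix (n : ℕ) : Type :=
  PresentedGroup
    ({genX ^ (2 * n), genY ^ 3, genX⁻¹ * genY * genX * (genY⁻¹)⁻¹} : Set (FreeGroup (Fin 2)))

/-- `U_{(n,m)} = ⟨x, y : x^{2n} = y^m = 1, x⁻¹ y x = y⁻¹⟩`. -/
abbrev GroupU (n m : ℕ) : Type :=
  PresentedGroup
    ({genX ^ (2 * n), genY ^ m, genX⁻¹ * genY * genX * (genY⁻¹)⁻¹} : Set (FreeGroup (Fin 2)))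

/-- `SD_{8n} = ⟨x, y : x^{4n} = y^2 = 1, y x y = x^{2n-1}⟩`; the exponent is an integer. -/
abbrev GroupSD (n : ℕ) : Type :=
  PresentedGroup
    ({genX ^ (4 * n), genY ^ 2, genY * genX * genY * (genX ^ (2 * (n : ℤ) - 1))⁻¹} :
      Set (FreeGroup (Fin 2)))

/-- `V_{8n} = ⟨x, y : x^{2n} = y^4 = 1, y x = x⁻¹ y⁻¹, y⁻¹ x = x⁻¹ y⟩`. -/
abbrev GroupV (n : ℕ) : Type :=
  PresentedGroup
    ({genX ^ (2 * n), genY ^ 4, genY * genX * (genX⁻¹ * genY⁻¹)⁻¹,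
      genY⁻¹ * genX * (genX⁻¹ * genY)⁻¹} : Set (FreeGroup (Fin 2)))

end Families

/-! Every group listed has commutation transitive on its non-central elements (`CommuteTransitive`).
Conjugating representatives carries this over to classes (`CommuteTransitive.adj_trans`), so the
graph is a disjoint union of cliques. On a clique of size s both matrices are a scalar plus a
multiple of the all-ones block: eigenvalues are s(s-2) and 0 for CNL, (s-2)^2 and 2(s-1)(s-2) for
CNSL. Transitivity comes from an abelian subgroup of index at most two
(`commuteTransitive_of_abelian_index_two`), except when the central quotient is Z_p × Z_p, where
centralizers of non-central elements are shown abelian directly. -/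

/-! ### Spectra of disjoint unions of complete graphs -/

section CliqueUnion

variable {V : Type*} [Fintype V]

open Classical in
/-- An integer matrix which is the sum of a diagonal matrix and of constant blocks along an
equivalence relation has integer eigenvalues. -/
theorem specWithMult_integral_of_blocks (A : Matrix V V ℤ) (r : Setoid V) (p q : V → ℤ)
    (hp : ∀ i j, r i j → p i = p j) (hq : ∀ i j, r i j → q i = q j)
    (hA : ∀ (v : V → ℂ) (i : V), (A.map (Int.cast : ℤ → ℂ)).mulVec v i =
      p i * v i + q i * ∑ j with r i j, v j) :
    ∀ α ∈ specWithMult A, ∃ k : ℤ, α = (k : ℂ) := by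
  intro α hα
  have hroot := Polynomial.isRoot_of_mem_roots hα
  rw [Polynomial.IsRoot, Matrix.eval_charpoly] at hroot
  obtain ⟨v, hv0, hv⟩ := Matrix.exists_mulVec_eq_zero_iff.mpr hroot
  have heig : ∀ i, α * v i = p i * v i + q i * ∑ j with r i j, v j := by
    intro i
    have h := congrFun hv i
    rw [Matrix.sub_mulVec, Pi.sub_apply, Pi.zero_apply, sub_eq_zero, hA] at h
    rw [← h]
    simp [Matrix.scalar_apply, Matrix.mulVec_diagonal]
  obtain ⟨i, hi⟩ := Function.ne_iff.mp hv0
  -- If the block sum of the eigenvector vanishes, row i gives α = p. Otherwise, summing the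
  -- eigenvalue equation over the block gives α = p + q · (block size).
  by_cases hsum : ∑ j with r i j, v j = 0
  · refine ⟨p i, mul_right_cancel₀ hi ?_⟩
    rw [heig i, hsum, mul_zero, add_zero]
  · refine ⟨p i + q i * (Finset.univ.filter fun j => r i j).card, mul_right_cancel₀ hsum ?_⟩
    have hclass : ∀ j ∈ Finset.univ.filter (fun j => r i j),
        α * v j = p i * v j + q i * ∑ k with r i k, v k := by
      intro j hj
      have hij : r i j := by simpa using hj
      rw [heig j, ← hp i j hij, ← hq i j hij]
      congr 3
      ext k
      simpa using ⟨fun h => r.trans hij h, fun h => r.trans (r.symm hij) h⟩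
    rw [Finset.mul_sum, Finset.sum_congr rfl hclass, Finset.sum_add_distrib, ← Finset.mul_sum,
      Finset.sum_const, nsmul_eq_mul]
    push_cast
    ring

/-- The equivalence relation "equal or adjacent" of a graph in which adjacency is transitive. -/
def SimpleGraph.cliqueSetoid (Γ : SimpleGraph V)
    (h : ∀ a b c, Γ.Adj a b → Γ.Adj b c → a ≠ c → Γ.Adj a c) : Setoid V where
  r a b := a = b ∨ Γ.Adj a b
  iseqv :=
    { refl := fun _ => Or.inl rfl
      symm := by
        rintro a b (rfl | hab)
        · exact Or.inl rfl
        · exact Or.inr hab.symm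
      trans := by
        rintro a b c (rfl | hab) (rfl | hbc)
        · exact Or.inl rfl
        · exact Or.inr hbc
        · exact Or.inr hab
        · by_cases hac : a = c
          · exact Or.inl hac
          · exact Or.inr (h a b c hab hbc hac) }

variable (Γ : SimpleGraph V) (h : ∀ a b c, Γ.Adj a b → Γ.Adj b c → a ≠ c → Γ.Adj a c)

-- Two distinct vertices of a clique of size s share exactly its other s - 2 vertices; different
-- cliques share none. The subtracted diagonal term also absorbs the value -1 arising from s = 1.
open Classical in
theorem CN_of_clique_union (i j : V) :
    CN Γ i j = (if Γ.cliqueSetoid h i j then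
        ((Finset.univ.filter fun k => Γ.cliqueSetoid h i k).card : ℤ) - 2 else 0) -
      (if i = j then
        ((Finset.univ.filter fun k => Γ.cliqueSetoid h i k).card : ℤ) - 2 else 0) := by
  by_cases hij : i = j
  · subst hij
    simp [CN, Setoid.refl]
  by_cases hr : Γ.cliqueSetoid h i j
  · have hset : Γ.commonNeighbors i j =
        (((Finset.univ.filter fun k => Γ.cliqueSetoid h i k).erase i).erase j : Finset V) := by
      ext k
      have hadj : Γ.Adj i j := hr.resolve_left hij
      simp only [SimpleGraph.mem_commonNeighbors, Finset.coe_erase, Finset.coe_filter,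
        Finset.mem_univ, true_and, Set.mem_sdiff, Set.mem_ofPred_eq, Set.mem_singleton_iff]
      constructor
      · rintro ⟨hik, hjk⟩
        exact ⟨⟨Or.inr hik, hik.ne'⟩, hjk.ne'⟩
      · rintro ⟨⟨hik, hki⟩, hkj⟩
        have hik := hik.resolve_left (Ne.symm hki)
        exact ⟨hik, h _ _ _ hadj.symm hik (Ne.symm hkj)⟩
    have hmi : i ∈ Finset.univ.filter fun k => Γ.cliqueSetoid h i k := by
      simp [Setoid.refl]
    have hmj : j ∈ (Finset.univ.filter fun k => Γ.cliqueSetoid h i k).erase i := by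
      simp [hr, Ne.symm hij]
    have h1 := Finset.card_erase_add_one hmi
    have h2 := Finset.card_erase_add_one hmj
    simp only [CN, Matrix.of_apply, ne_eq, hij, not_false_eq_true, if_true, hr, if_false, sub_zero]
    rw [hset, Set.ncard_coe_finset]
    omega
  · have hset : Γ.commonNeighbors i j = ∅ := by
      ext k
      simp only [SimpleGraph.mem_commonNeighbors, Set.mem_empty_iff_false, iff_false]
      rintro ⟨hik, hjk⟩
      exact hr (Or.inr (h _ _ _ hik hjk.symm hij))
    simp [CN, hij, hr, hset]

open Classical in
theorem CNRS_of_clique_union (i : V) :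
    ∑ k, CN Γ i k = (((Finset.univ.filter fun k => Γ.cliqueSetoid h i k).card : ℤ) - 1) *
      (((Finset.univ.filter fun k => Γ.cliqueSetoid h i k).card : ℤ) - 2) := by
  simp only [CN_of_clique_union Γ h, Finset.sum_sub_distrib, Finset.sum_ite_eq, Finset.mem_univ,
    if_true, ← Finset.sum_filter, Finset.sum_const, nsmul_eq_mul]
  ring

open Classical in
theorem CN_mulVec_of_clique_union (v : V → ℂ) (i : V) :
    ((CN Γ).map (Int.cast : ℤ → ℂ)).mulVec v i =
      (((Finset.univ.filter fun k => Γ.cliqueSetoid h i k).card : ℤ) - 2 : ℤ) *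
        ((∑ j with Γ.cliqueSetoid h i j, v j) - v i) := by
  simp only [Matrix.mulVec, dotProduct, Matrix.map_apply, CN_of_clique_union Γ h, Int.cast_sub,
    Int.cast_ite, Int.cast_zero, sub_mul, ite_mul, zero_mul, Finset.sum_sub_distrib,
    Finset.sum_ite_eq, Finset.mem_univ, if_true, ← Finset.sum_filter, ← Finset.mul_sum]
  ring

open Classical in
theorem CNRS_mulVec_of_clique_union (v : V → ℂ) (i : V) :
    ((CNRS Γ).map (Int.cast : ℤ → ℂ)).mulVec v i =
      ((((Finset.univ.filter fun k => Γ.cliqueSetoid h i k).card : ℤ) - 1) *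
      (((Finset.univ.filter fun k => Γ.cliqueSetoid h i k).card : ℤ) - 2) : ℤ) * v i := by
  rw [CNRS, Matrix.diagonal_map Int.cast_zero, Matrix.mulVec_diagonal,
    CNRS_of_clique_union Γ h]

open Classical in
theorem card_clique_eq {i j : V} (hij : Γ.cliqueSetoid h i j) :
    (Finset.univ.filter fun k => Γ.cliqueSetoid h i k).card =
      (Finset.univ.filter fun k => Γ.cliqueSetoid h j k).card := by
  congr 1
  ext k
  simpa using ⟨fun hk => (Γ.cliqueSetoid h).trans ((Γ.cliqueSetoid h).symm hij) hk,
    fun hk => (Γ.cliqueSetoid h).trans hij hk⟩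

/-- A disjoint union of complete graphs is CNL-integral. -/
theorem isCNLIntegral_of_clique_union
    (h : ∀ a b c, Γ.Adj a b → Γ.Adj b c → a ≠ c → Γ.Adj a c) : IsCNLIntegral Γ := by
  classical
  let s : V → ℤ := fun i => (Finset.univ.filter fun k => Γ.cliqueSetoid h i k).card
  have hs : ∀ i j, Γ.cliqueSetoid h i j → s i = s j := fun i j hij =>
    congrArg Nat.cast (card_clique_eq Γ h hij)
  refine specWithMult_integral_of_blocks _ (Γ.cliqueSetoid h) (fun i => s i * (s i - 2))
    (fun i => -(s i - 2)) (fun i j hij => by simp only [hs i j hij])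
    (fun i j hij => by simp only [hs i j hij]) fun v i => ?_
  rw [CNL, Matrix.map_sub _ (fun a b => Int.cast_sub a b), Matrix.sub_mulVec, Pi.sub_apply,
    CNRS_mulVec_of_clique_union Γ h, CN_mulVec_of_clique_union Γ h]
  simp only [s]
  push_cast
  ring

/-- A disjoint union of complete graphs is CNSL-integral. -/
theorem isCNSLIntegral_of_clique_union
    (h : ∀ a b c, Γ.Adj a b → Γ.Adj b c → a ≠ c → Γ.Adj a c) : IsCNSLIntegral Γ := by
  classical
  let s : V → ℤ := fun i => (Finset.univ.filter fun k => Γ.cliqueSetoid h i k).card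
  have hs : ∀ i j, Γ.cliqueSetoid h i j → s i = s j := fun i j hij =>
    congrArg Nat.cast (card_clique_eq Γ h hij)
  refine specWithMult_integral_of_blocks _ (Γ.cliqueSetoid h) (fun i => (s i - 2) * (s i - 2))
    (fun i => s i - 2) (fun i j hij => by simp only [hs i j hij])
    (fun i j hij => by simp only [hs i j hij]) fun v i => ?_
  rw [CNSL, Matrix.map_add _ (fun a b => Int.cast_add a b), Matrix.add_mulVec, Pi.add_apply,
    CNRS_mulVec_of_clique_union Γ h, CN_mulVec_of_clique_union Γ h]
  simp only [s]
  push_cast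
  ring

end CliqueUnion

/-! ### Criteria for transitivity of commutation -/

section Commutation

/-- Commutation is transitive on the non-central elements: equivalently, centralizers of
non-central elements are abelian. -/
def CommuteTransitive (G : Type*) [Group G] : Prop :=
  ∀ x y z : G, y ∉ Subgroup.center G → Commute x y → Commute y z → Commute x z

variable {G : Type*} [Group G]

theorem CommuteTransitive.adj_trans (hG : CommuteTransitive G) (a b c : CCCVertex G)
    (hab : (CCCGraph G).Adj a b) (hbc : (CCCGraph G).Adj b c) (hac : a ≠ c) :
    (CCCGraph G).Adj a c := by
  obtain ⟨-, x, hx, y, hy, hxy⟩ := hab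
  obtain ⟨-, y', hy', z, hz, hyz⟩ := hbc
  refine ⟨hac, ?_⟩
  obtain ⟨w, hw, hwb⟩ := b.2
  rw [ConjClasses.mem_carrier_iff_mk_eq] at hx hy hy' hz
  have hconj : IsConj y' y := ConjClasses.mk_eq_mk_iff_isConj.mp (hy'.trans hy.symm)
  have hwy : IsConj y w := ConjClasses.mk_eq_mk_iff_isConj.mp (hy.trans hwb.symm)
  -- The two edges may use different representatives of the middle class; conjugating the second
  -- commuting pair by g makes them agree.
  obtain ⟨g, rfl⟩ := isConj_iff.mp hconj
  have hync : g * y' * g⁻¹ ∉ Subgroup.center G := by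
    intro hmem
    obtain ⟨k, rfl⟩ := isConj_iff.mp hwy
    exact hw (Subgroup.Normal.conj_mem inferInstance _ hmem k)
  refine ⟨x, ConjClasses.mem_carrier_iff_mk_eq.mpr hx, g * z * g⁻¹, ?_, ?_⟩
  · rw [ConjClasses.mem_carrier_iff_mk_eq, ← hz, ConjClasses.mk_eq_mk_iff_isConj]
    exact (isConj_iff.mpr ⟨g, rfl⟩).symm
  · refine hG _ _ _ hync hxy ?_
    have hyz' : Commute y' z := hyz
    exact (Commute.conj_iff g).mpr hyz'

/-- A group with an abelian subgroup of index at most two has abelian centralizers of non-central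
elements. -/
theorem commuteTransitive_of_abelian_index_two (A : Subgroup G)
    (hA : ∀ a ∈ A, ∀ b ∈ A, Commute a b) (hidx : ∀ g h, g ∉ A → h ∉ A → g * h ∈ A) :
    CommuteTransitive G := by
  -- Together, A and any single g outside it generate G.
  have hcent : ∀ a ∈ A, ∀ g, g ∉ A → Commute a g → a ∈ Subgroup.center G := by
    intro a ha g hg hag
    refine Subgroup.mem_center_iff.mpr fun k => ?_
    by_cases hk : k ∈ A
    · exact hA k hk a ha
    · have h1 : Commute a (k * g) := hA a ha _ (hidx k g hk hg)
      have h2 : Commute a (k * g * g⁻¹) := h1.mul_right hag.inv_right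
      rw [mul_inv_cancel_right] at h2
      exact h2.symm.eq
  have hcomm : ∀ a g : G, a ∈ Subgroup.center G → Commute a g := fun a g ha =>
    (Subgroup.mem_center_iff.mp ha g).symm
  intro x y z hy hxy hyz
  by_cases hyA : y ∈ A
  · have hxA : x ∈ A := by_contra fun hx => hy (hcent y hyA x hx hxy.symm)
    have hzA : z ∈ A := by_contra fun hz => hy (hcent y hyA z hz hyz)
    exact hA x hxA z hzA
  · by_cases hxA : x ∈ A
    · exact hcomm x z (hcent x hxA y hyA hxy)
    by_cases hzA : z ∈ A
    · exact (hcomm z x (hcent z hzA y hyA hyz.symm)).symm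
    -- With x and y both outside A, x differs from y by a central factor, hence commutes with
    -- whatever y does.
    have hyi : y⁻¹ ∉ A := fun hmem => hyA (inv_mem_iff.mp hmem)
    have h1 : x * y⁻¹ ∈ Subgroup.center G :=
      hcent _ (hidx x y⁻¹ hxA hyi) y hyA (hxy.mul_left (Commute.refl y).inv_left)
    have h2 : Commute (x * y⁻¹ * y) z := (hcomm _ z h1).mul_left hyz
    rwa [inv_mul_cancel_right] at h2

/-- A central extension of a cyclic group is abelian. -/
theorem commute_of_map_mem_isCyclic {H : Type*} [Group H] (f : G →* H)
    (hf : f.ker ≤ Subgroup.center G) (B : Subgroup H) [IsCyclic B] :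
    ∀ a ∈ B.comap f, ∀ b ∈ B.comap f, Commute a b := by
  intro a ha b hb
  let φ : B.comap f →* B := f.subgroupComap B
  have hker : φ.ker ≤ Subgroup.center (B.comap f) := by
    intro k hk
    have hk' : (k : G) ∈ f.ker := congrArg Subtype.val (MonoidHom.mem_ker.mp hk)
    exact Subgroup.mem_center_iff.mpr fun g =>
      Subtype.ext (Subgroup.mem_center_iff.mp (hf hk') g)
  have := MonoidHom.isMulCommutative_of_isCyclic_of_ker_le_center φ hker
  exact congrArg Subtype.val (mul_comm' (⟨a, ha⟩ : B.comap f) ⟨b, hb⟩)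

theorem commuteTransitive_of_isCyclic_index_two {H : Type*} [Group H] (f : G →* H)
    (hf : f.ker ≤ Subgroup.center G) (B : Subgroup H) [IsCyclic B]
    (hidx : ∀ g h, g ∉ B → h ∉ B → g * h ∈ B) : CommuteTransitive G :=
  commuteTransitive_of_abelian_index_two (B.comap f) (commute_of_map_mem_isCyclic f hf B)
    fun g h hg hh => by
      rw [Subgroup.mem_comap, map_mul]
      exact hidx _ _ hg hh

theorem CommuteTransitive.of_mulEquiv {H : Type*} [Group H] (e : G ≃* H)
    (hH : CommuteTransitive H) : CommuteTransitive G := by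
  intro x y z hy hxy hyz
  have hy' : e y ∉ Subgroup.center H := by
    intro hmem
    refine hy (Subgroup.mem_center_iff.mpr fun g => e.injective ?_)
    simpa using Subgroup.mem_center_iff.mp hmem (e g)
  have h := hH (e x) (e y) (e z) hy' (hxy.map e) (hyz.map e)
  exact e.injective (by simpa using h.eq)

/-- A group generated by an abelian subgroup and an element normalizing it whose square lies in it
has abelian centralizers of non-central elements. -/
theorem commuteTransitive_of_closure (S : Set G) (t : G)
    (hS : ∀ a ∈ S, ∀ b ∈ S, a * b = b * a)
    (ht : t * t ∈ Subgroup.closure S)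
    (hconj : ∀ a ∈ S, t * a * t⁻¹ ∈ Subgroup.closure S)
    (hconj' : ∀ a ∈ S, t⁻¹ * a * t ∈ Subgroup.closure S)
    (hgen : Subgroup.closure (insert t S) = ⊤) : CommuteTransitive G := by
  set A := Subgroup.closure S
  have hA : ∀ a ∈ A, ∀ b ∈ A, Commute a b := by
    intro a ha b hb
    have := Subgroup.isMulCommutative_closure hS
    exact congrArg Subtype.val (mul_comm' (⟨a, ha⟩ : A) ⟨b, hb⟩)
  have hc : ∀ g : G, (∀ a ∈ S, g * a * g⁻¹ ∈ A) → ∀ a ∈ A, g * a * g⁻¹ ∈ A := by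
    intro g hg
    have hle : A ≤ A.comap (MulAut.conj g).toMonoidHom :=
      (Subgroup.closure_le _).mpr fun a ha => hg a ha
    exact fun a ha => hle ha
  have hc1 := hc t hconj
  have hc2 := hc t⁻¹ (by simpa using hconj')
  rw [inv_inv] at hc2
  have hnorm : Subgroup.closure (insert t S) ≤ Subgroup.normalizer (A : Set G) := by
    refine (Subgroup.closure_le _).mpr ?_
    rintro g (rfl | hg)
    · refine Subgroup.mem_normalizer_iff.mpr fun a => ⟨hc1 a, fun ha => ?_⟩
      have := hc2 _ ha
      simpa [mul_assoc] using this
    · exact Subgroup.le_normalizer (Subgroup.subset_closure hg)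
  have hnormal : A.Normal := Subgroup.normalizer_eq_top_iff.mp (top_le_iff.mp (hgen ▸ hnorm))
  -- Since A is normal, each element is a · t^k with a in A; only the parity of k matters because t²
  -- lies in A.
  have hform : ∀ g : G, g ∈ A ∨ g * t ∈ A := by
    intro g
    have hg : g ∈ A ⊔ Subgroup.zpowers t := by
      have : Subgroup.closure (insert t S) ≤ A ⊔ Subgroup.zpowers t := by
        refine (Subgroup.closure_le _).mpr ?_
        rintro g (rfl | hg)
        · exact Subgroup.mem_sup_right (Subgroup.mem_zpowers g)
        · exact Subgroup.mem_sup_left (Subgroup.subset_closure hg)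
      exact this (hgen ▸ Subgroup.mem_top g)
    obtain ⟨a, ha, b, hb, rfl⟩ := Subgroup.mem_sup_of_normal_left.mp hg
    obtain ⟨k, rfl⟩ := Subgroup.mem_zpowers_iff.mp hb
    have heven : ∀ l : ℤ, t ^ (l + l) ∈ A := fun l => by
      rw [← two_mul, zpow_mul, zpow_two]
      exact A.zpow_mem ht l
    obtain ⟨l, rfl⟩ | ⟨l, rfl⟩ := Int.even_or_odd k
    · exact Or.inl (A.mul_mem ha (heven l))
    · refine Or.inr ?_
      rw [mul_assoc, ← zpow_add_one, show 2 * l + 1 + 1 = (l + 1) + (l + 1) by ring]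
      exact A.mul_mem ha (heven _)
  refine commuteTransitive_of_abelian_index_two A hA fun g k hg hk => ?_
  have h1 := (hform g).resolve_left hg
  have h2 : k⁻¹ * t ∈ A := (hform k⁻¹).resolve_left fun hmem => hk (inv_mem_iff.mp hmem)
  simpa [mul_assoc] using A.mul_mem h1 (A.inv_mem h2)

/-- The centralizer of a non-central y contains the center and has proper image in a group of order
p². That image is cyclic, so the centralizer is abelian. -/
theorem commuteTransitive_of_quotient_center_zmod_prod [Finite G] {p : ℕ} (hp : p.Prime)
    (e : G ⧸ Subgroup.center G ≃* Multiplicative (ZMod p) × Multiplicative (ZMod p)) :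
    CommuteTransitive G := by
  have : Fact p.Prime := ⟨hp⟩
  intro x y z hy hxy hyz
  let B : Subgroup (G ⧸ Subgroup.center G) :=
    (Subgroup.centralizer {y}).map (QuotientGroup.mk' (Subgroup.center G))
  have hcomap : B.comap (QuotientGroup.mk' (Subgroup.center G)) = Subgroup.centralizer {y} := by
    rw [Subgroup.comap_map_eq_self]
    rw [QuotientGroup.ker_mk']
    exact Subgroup.center_le_centralizer _
  have hcardQ : Nat.card (G ⧸ Subgroup.center G) = p ^ 2 := by
    rw [Nat.card_congr e.toEquiv, Nat.card_prod]
    simp [sq]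
  have hBtop : B ≠ ⊤ := by
    intro hB
    rw [hB, Subgroup.comap_top] at hcomap
    refine hy (Subgroup.mem_center_iff.mpr fun g => ?_)
    have hg : g ∈ Subgroup.centralizer {y} := hcomap ▸ Subgroup.mem_top g
    exact (Subgroup.mem_centralizer_singleton_iff.mp hg)
  have hcardB : Nat.card B ∣ p := by
    obtain ⟨k, hk, hkB⟩ := (Nat.dvd_prime_pow hp).mp (hcardQ ▸ Subgroup.card_subgroup_dvd_card B)
    have hk2 : k ≠ 2 := by
      rintro rfl
      exact hBtop (Subgroup.eq_top_of_card_eq B (hkB.trans hcardQ.symm))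
    rw [hkB]
    exact (pow_dvd_pow p (show k ≤ 1 by omega)).trans (pow_one p).dvd
  have : IsCyclic B := isCyclic_of_card_dvd_prime hcardB
  refine commute_of_map_mem_isCyclic (QuotientGroup.mk' (Subgroup.center G))
    (QuotientGroup.ker_mk' _).le B x ?_ z ?_ <;>
  rw [hcomap, Subgroup.mem_centralizer_singleton_iff]
  exacts [hxy.eq, hyz.symm.eq]

end Commutation

/-! ### The dihedral, quaternion and presented families -/

section Families

theorem DihedralGroup.mul_mem_zpowers_r_one {n : ℕ} (g h : DihedralGroup n)
    (hg : g ∉ Subgroup.zpowers (DihedralGroup.r 1 : DihedralGroup n))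
    (hh : h ∉ Subgroup.zpowers (DihedralGroup.r 1 : DihedralGroup n)) :
    g * h ∈ Subgroup.zpowers (DihedralGroup.r 1 : DihedralGroup n) := by
  have hr : ∀ i : ZMod n, DihedralGroup.r i ∈ Subgroup.zpowers (DihedralGroup.r 1) := by
    intro i
    obtain ⟨k, rfl⟩ := ZMod.intCast_surjective i
    exact ⟨k, by simp⟩
  obtain i | i := g
  · exact absurd (hr i) hg
  obtain j | j := h
  · exact absurd (hr j) hh
  rw [DihedralGroup.sr_mul_sr]
  exact hr _

theorem QuaternionGroup.mul_mem_zpowers_a_one {n : ℕ} (g h : QuaternionGroup n)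
    (hg : g ∉ Subgroup.zpowers (QuaternionGroup.a 1 : QuaternionGroup n))
    (hh : h ∉ Subgroup.zpowers (QuaternionGroup.a 1 : QuaternionGroup n)) :
    g * h ∈ Subgroup.zpowers (QuaternionGroup.a 1 : QuaternionGroup n) := by
  have ha : ∀ i : ZMod (2 * n), QuaternionGroup.a i ∈ Subgroup.zpowers (QuaternionGroup.a 1) := by
    intro i
    have hpow : ∀ k : ℕ, (QuaternionGroup.a 1 : QuaternionGroup n) ^ k = QuaternionGroup.a k :=
      QuaternionGroup.a_one_pow
    obtain ⟨k, rfl⟩ := ZMod.intCast_surjective i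
    refine ⟨k, ?_⟩
    obtain ⟨m, rfl | rfl⟩ := k.eq_nat_or_neg
    · simp [hpow]
    · simp only [zpow_neg, zpow_natCast, hpow]
      simp
      rfl
  obtain i | i := g
  · exact absurd (ha i) hg
  obtain j | j := h
  · exact absurd (ha j) hh
  rw [QuaternionGroup.xa_mul_xa]
  exact ha _

theorem PresentedGroup.closure_pair (rels : Set (FreeGroup (Fin 2))) :
    Subgroup.closure {PresentedGroup.mk rels genX, PresentedGroup.mk rels genY} = ⊤ := by
  rw [← PresentedGroup.closure_range_of rels]
  congr 1
  ext g
  simp only [Set.mem_insert_iff, Set.mem_singleton_iff, Set.mem_range, Fin.exists_fin_two]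
  exact or_congr eq_comm eq_comm

variable {G : Type*} [Group G] {x y : G}

/-- Conjugation by x inverts y, so x² commutes with y and ⟨x², y⟩ is the abelian subgroup. -/
theorem commuteTransitive_of_conj_inv (hgen : Subgroup.closure {x, y} = ⊤)
    (h1 : x⁻¹ * y * x = y⁻¹) : CommuteTransitive G := by
  have h2 : x * y * x⁻¹ = y⁻¹ := by
    have h := congrArg (fun g => (x * g * x⁻¹)⁻¹) h1
    simp only [mul_assoc, mul_inv_cancel_left, mul_inv_cancel, mul_one, mul_inv_rev, inv_inv] at h
    rw [h, mul_assoc]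
  have h3 : x * x * y = y * (x * x) := by
    have h4 : x * y = y⁻¹ * x := by rw [← h2]; group
    have h5 : x * y⁻¹ = y * x := by rw [← h1]; group
    rw [mul_assoc x x y, h4, ← mul_assoc, h5]; group
  have hx : x * x ∈ Subgroup.closure {x * x, y} := Subgroup.subset_closure (by simp)
  have hy : y ∈ Subgroup.closure {x * x, y} := Subgroup.subset_closure (by simp)
  refine commuteTransitive_of_closure {x * x, y} x ?_ hx ?_ ?_ ?_
  · rintro a (rfl | rfl) b (rfl | rfl)
    exacts [rfl, h3, h3.symm, rfl]
  · rintro a (rfl | rfl)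
    · simpa [mul_assoc] using hx
    · rw [h2]; exact inv_mem hy
  · rintro a (rfl | rfl)
    · simpa [mul_assoc] using hx
    · rw [h1]; exact inv_mem hy
  · refine top_le_iff.mp (hgen.ge.trans (Subgroup.closure_mono ?_))
    rintro g (rfl | rfl) <;> simp

theorem commuteTransitive_of_conj_zpow (hgen : Subgroup.closure {x, y} = ⊤) (hy : y ^ 2 = 1)
    {k : ℤ} (hk : y * x * y = x ^ k) : CommuteTransitive G := by
  rw [sq] at hy
  have hyi : y⁻¹ = y := inv_eq_of_mul_eq_one_left hy
  have hx : x ∈ Subgroup.closure {x} := Subgroup.subset_closure rfl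
  refine commuteTransitive_of_closure {x} y ?_ (hy ▸ one_mem _) ?_ ?_ ?_
  · rintro a rfl b rfl
    rfl
  · rintro a rfl
    rw [hyi, hk]
    exact zpow_mem hx _
  · rintro a rfl
    rw [hyi, hk]
    exact zpow_mem hx _
  · rwa [Set.pair_comm]

/-- The abelian subgroup is ⟨x, y²⟩, and y is the extra generator. -/
theorem commuteTransitive_of_mul_eq_inv_mul_inv (hgen : Subgroup.closure {x, y} = ⊤)
    (hy4 : y ^ 4 = 1) (h1 : y * x = x⁻¹ * y⁻¹) (h2 : y⁻¹ * x = x⁻¹ * y) :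
    CommuteTransitive G := by
  have hyi : (y * y)⁻¹ = y * y := inv_eq_of_mul_eq_one_left (by
    simpa [pow_succ, mul_assoc] using hy4)
  have h3 : x * (y * y) = y * y * x := by
    -- The relations make both bracketed words equal to x⁻¹.
    have h4 : y⁻¹ * (y * x * y) * y⁻¹ = y⁻¹ * (y⁻¹ * x * y⁻¹) * y⁻¹ := by
      rw [h1, h2]; simp [mul_assoc]
    have h5 : x = (y * y)⁻¹ * x * (y * y)⁻¹ := by simpa [mul_assoc] using h4
    calc x * (y * y) = (y * y)⁻¹ * x * (y * y)⁻¹ * (y * y) := by rw [← h5]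
      _ = y * y * x := by rw [inv_mul_cancel_right, hyi]
  have hx : x ∈ Subgroup.closure {x, y * y} := Subgroup.subset_closure (by simp)
  have hy : y * y ∈ Subgroup.closure {x, y * y} := Subgroup.subset_closure (by simp)
  refine commuteTransitive_of_closure {x, y * y} y ?_ hy ?_ ?_ ?_
  · rintro a (rfl | rfl) b (rfl | rfl)
    exacts [rfl, h3, h3.symm, rfl]
  · rintro a (rfl | rfl)
    · rw [h1, mul_assoc, ← mul_inv_rev]
      exact mul_mem (inv_mem hx) (inv_mem hy)
    · simpa [mul_assoc] using hy
  · rintro a (rfl | rfl)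
    · rw [h2, mul_assoc]
      exact mul_mem (inv_mem hx) hy
    · simpa [mul_assoc] using hy
  · refine top_le_iff.mp (hgen.ge.trans (Subgroup.closure_mono ?_))
    rintro g (rfl | rfl) <;> simp

theorem commuteTransitive_GroupU (n m : ℕ) : CommuteTransitive (GroupU n m) :=
  commuteTransitive_of_conj_inv (PresentedGroup.closure_pair _) <|
    mul_inv_eq_one.mp (PresentedGroup.one_of_mem (x := genX⁻¹ * genY * genX * (genY⁻¹)⁻¹) (by simp))

theorem commuteTransitive_GroupSD (n : ℕ) : CommuteTransitive (GroupSD n) :=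
  commuteTransitive_of_conj_zpow (k := 2 * (n : ℤ) - 1) (PresentedGroup.closure_pair _)
    (PresentedGroup.one_of_mem (x := genY ^ 2) (by simp)) <|
    mul_inv_eq_one.mp (PresentedGroup.one_of_mem
      (x := genY * genX * genY * (genX ^ (2 * (n : ℤ) - 1))⁻¹) (by simp))

theorem commuteTransitive_GroupV (n : ℕ) : CommuteTransitive (GroupV n) :=
  commuteTransitive_of_mul_eq_inv_mul_inv (PresentedGroup.closure_pair _)
    (PresentedGroup.one_of_mem (x := genY ^ 4) (by simp))
    (mul_inv_eq_one.mp
      (PresentedGroup.one_of_mem (x := genY * genX * (genX⁻¹ * genY⁻¹)⁻¹) (by simp)))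
    (mul_inv_eq_one.mp
      (PresentedGroup.one_of_mem (x := genY⁻¹ * genX * (genX⁻¹ * genY)⁻¹) (by simp)))

end Families

theorem mainTheorem8 (G : Type*) [Group G] [Finite G]
    (hG : ¬ ∀ a b : G, a * b = b * a)
    (h :
      (∃ p : ℕ, p.Prime ∧
        Nonempty (G ⧸ Subgroup.center G ≃* Multiplicative (ZMod p) × Multiplicative (ZMod p))) ∨
      (∃ n : ℕ, 3 ≤ n ∧ Nonempty (G ⧸ Subgroup.center G ≃* DihedralGroup n)) ∨
      (∃ n : ℕ, 3 ≤ n ∧ Nonempty (G ≃* DihedralGroup n)) ∨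
      (∃ n : ℕ, 2 ≤ n ∧ Nonempty (G ≃* QuaternionGroup n)) ∨
      (∃ n : ℕ, 2 ≤ n ∧ Nonempty (G ≃* GroupUSix n)) ∨
      (∃ n m : ℕ, 2 ≤ n ∧ 2 ≤ m ∧ Nonempty (G ≃* GroupU n m)) ∨
      (∃ n : ℕ, 2 ≤ n ∧ Nonempty (G ≃* GroupSD n)) ∨
      (∃ n : ℕ, 2 ≤ n ∧ Nonempty (G ≃* GroupV n))) :
    IsCNLIntegral (CCCGraph G) ∧ IsCNSLIntegral (CCCGraph G) := by

  suffices hT : CommuteTransitive G from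
    ⟨isCNLIntegral_of_clique_union _ hT.adj_trans, isCNSLIntegral_of_clique_union _ hT.adj_trans⟩
  have hker : ∀ {H : Type} [Group H] (e : G ≃* H), e.toMonoidHom.ker ≤ Subgroup.center G := by
    intro H _ e
    rw [(MonoidHom.ker_eq_bot_iff e.toMonoidHom).mpr e.injective]
    exact bot_le
  obtain ⟨p, hp, ⟨e⟩⟩ | ⟨n, -, ⟨e⟩⟩ | ⟨n, -, ⟨e⟩⟩ | ⟨n, -, ⟨e⟩⟩ | ⟨n, -, ⟨e⟩⟩ |
    ⟨n, m, -, -, ⟨e⟩⟩ | ⟨n, -, ⟨e⟩⟩ | ⟨n, -, ⟨e⟩⟩ := h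
  · exact commuteTransitive_of_quotient_center_zmod_prod hp e
  · refine commuteTransitive_of_isCyclic_index_two
      (e.toMonoidHom.comp (QuotientGroup.mk' (Subgroup.center G))) ?_
      (Subgroup.zpowers (DihedralGroup.r 1)) DihedralGroup.mul_mem_zpowers_r_one
    intro g hg
    have h1 : e (QuotientGroup.mk' _ g) = 1 := hg
    exact (QuotientGroup.eq_one_iff g).mp (e.map_eq_one_iff.mp h1)
  · exact commuteTransitive_of_isCyclic_index_two e.toMonoidHom (hker e)
      (Subgroup.zpowers (DihedralGroup.r 1)) DihedralGroup.mul_mem_zpowers_r_one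
  · exact commuteTransitive_of_isCyclic_index_two e.toMonoidHom (hker e)
      (Subgroup.zpowers (QuaternionGroup.a 1)) QuaternionGroup.mul_mem_zpowers_a_one
  -- The presentation of U_{6n} is that of U_{(n,3)}.
  · exact (commuteTransitive_GroupU n 3).of_mulEquiv e
  · exact (commuteTransitive_GroupU n m).of_mulEquiv e
  · exact (commuteTransitive_GroupSD n).of_mulEquiv e
  · exact (commuteTransitive_GroupV n).of_mulEquiv e
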